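/- Let $g_1\in\mathbb R$, $L>0$, and let $V:\mathbb R\to\mathbb R$ be continuous, $L$-periodic and even, with $V_{\min}\le V(x)\le V_{\max}$ for all $x$, where $V_{\min},V_{\max}$ are real constants. For $\omega\in\mathbb R$ consider $$\varphi''+(\omega+V(x))\varphi-g_1\varphi^3-\varphi^5=0,\qquad(\ast)$$ the equation for standing waves $\psi(t,x)=e^{-i\omega t}\varphi(x)$ of the cubic-quintic Schrödinger equation $i\psi_t+\psi_{xx}+V\psi-g_1|\psi|^2\psi-|\psi|^4\psi=0$. For $\omega>-V_{\min}$ put $$\rho_1=\sqrt{\tfrac12\Big(\sqrt{g_1^2+4(\omega+V_{\min})}-g_1\Big)},\qquad \rho_2=\sqrt{\tfrac12\Big(\sqrt{g_1^2+4(\omega+V_{\max})}-g_1\Big)}.$$ We say that $(\mathrm{DS}_\omega)$ holds for a function $\phi$ if $\phi$ is an odd $C^2$ solution of $(\ast)$, $(\ast)$ has exactly one $L$-periodic $C^2$ solution $\phi_+$ with $\rho_1\le\phi_+\le\rho_2$, this $\phi_+$ is positive, $e^{-i\omega t}\phi(x)$ solves the cubic-quintic Schrödinger equation, and $$\phi(x)\mp\phi_+(x)\to0,\qquad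 \phi'(x)\mp\phi_+'(x)\to0\qquad\text{as }x\to\pm\infty ,$$ i.e. $\phi$ is a dark soliton asymptotic to $\pm\phi_+$ at $\pm\infty$. (a) Suppose that $\omega>-V_{\min}$ and that at least one of the following holds: (i) $5y^4+3g_1y^2-(\omega+V(x))>0$ for all $x\in[0,L]$ and $y\in[\rho_1,\rho_2]$; (ii) $g_1\ge0$ and $\omega-g_1\sqrt{g_1^2+4\omega+4V_{\min}}>V_{\max}-5V_{\min}$; (iii) $g_1<0$ and $8\omega+2g_1^2+10V_{\min}-2V_{\max}-5g_1\sqrt{4\omega+g_1^2+4V_{\min}}+3g_1\sqrt{4\omega+g_1^2+4V_{\max}}>0$. Then there is a function $\phi$ for which $(\mathrm{DS}_\omega)$ holds. (b) Let $$\omega_0=\tfrac14\Big(\big(2g_1+\sqrt{\max\{0,\,5g_1^2+4(V_{\max}-4V_{\min})\}}\,\big)^2-g_1^2\Big)-V_{\min}\quad\text{if } g_1\ge0,$$ $$\omega_0=\max\Big\{-V_{\min},\ \tfrac14\big(V_{\max}-5V_{\min}-g_1^2+3|g_1|\sqrt{V_{\max}-V_{\min}}\big)\Big\}\quad\text{if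 } g_1<0 .$$ Then every $\omega>\omega_0$ satisfies $\omega>-V_{\min}$ and (ii) if $g_1\ge0$, respectively (iii) if $g_1<0$. Moreover, for each $\omega>\omega_0$ one can choose a function $\phi_\omega$ for which $(\mathrm{DS}_\omega)$ holds, such that $\phi_\omega\ne\phi_{\omega'}$ whenever $\omega\neq\omega'$. -/

import Mathlib

open Filter Topology

noncomputable section

namespace DarkSoliton

/-- Classical (`C²` in space, differentiable in time) solutions `ψ(t,x)` of the cubic-quintic NLS
`i ψ_t + ψ_xx + V ψ - g₁ |ψ|² ψ - g₂ |ψ|⁴ ψ = 0`. -/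
def IsCQNLSSolution (g₁ g₂ : ℝ) (V : ℝ → ℝ) (ψ : ℝ → ℝ → ℂ) : Prop :=
  (∀ x, Differentiable ℝ fun t => ψ t x) ∧ (∀ t, ContDiff ℝ 2 (ψ t)) ∧
    ∀ t x, Complex.I * deriv (fun s => ψ s x) t + deriv (deriv (ψ t)) x + (V x : ℂ) * ψ t x
      - (g₁ : ℂ) * ((‖ψ t x‖ ^ 2 : ℝ) : ℂ) * ψ t x
      - (g₂ : ℂ) * ((‖ψ t x‖ ^ 4 : ℝ) : ℂ) * ψ t x = 0

/-- Classical solutions of the stationary equation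
`φ'' + (ω + V) φ - g₁ φ³ - g₂ φ⁵ = 0`. -/
def IsStationarySolution (g₁ g₂ ω : ℝ) (V φ : ℝ → ℝ) : Prop :=
  ContDiff ℝ 2 φ ∧
    ∀ x, deriv (deriv φ) x + (ω + V x) * φ x - g₁ * φ x ^ 3 - g₂ * φ x ^ 5 = 0

/-- The profile `φ` of a dark soliton `ψ(t,x) = e^{-iωt} φ(x)`, joining a negative `L`-periodic
stationary solution `φm` at `-∞` to a positive one `φp` at `+∞` (together with the derivatives, so
that it is a heteroclinic orbit of the Poincaré map). -/
structure IsDarkSoliton (g₁ g₂ ω L : ℝ) (V φ φm φp : ℝ → ℝ) : Prop where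
  stationary : IsStationarySolution g₁ g₂ ω V φ
  cqnls : IsCQNLSSolution g₁ g₂ V
    (fun t x => Complex.exp (-(Complex.I * (ω : ℂ) * (t : ℂ))) * (φ x : ℂ))
  stationary_left : IsStationarySolution g₁ g₂ ω V φm
  stationary_right : IsStationarySolution g₁ g₂ ω V φp
  periodic_left : Function.Periodic φm L
  periodic_right : Function.Periodic φp L
  neg_left : ∀ x, φm x < 0
  pos_right : ∀ x, 0 < φp x
  tendsto_left : Tendsto (fun x => φ x - φm x) atBot (𝓝 0)
  tendsto_deriv_left : Tendsto (fun x => deriv φ x - deriv φm x) atBot (𝓝 0)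
  tendsto_right : Tendsto (fun x => φ x - φp x) atTop (𝓝 0)
  tendsto_deriv_right : Tendsto (fun x => deriv φ x - deriv φp x) atTop (𝓝 0)

/-- The positive equilibrium `ρ` of `φ'' + μ φ - g₁ φ³ - φ⁵ = 0`, where `μ = λ² > 0`. -/
def equilibrium (g₁ μ : ℝ) : ℝ :=
  √(√(g₁ ^ 2 + 4 * μ) - g₁) / √2

/-- `L`-periodic stationary solutions (with `g₂ = 1`) lying between the equilibria `ρ₁`, `ρ₂` of
the equations in which `V` is replaced by the constants `Vmin`, `Vmax`. -/
def IsPeriodicBackground (g₁ ω L Vmin Vmax : ℝ) (V χ : ℝ → ℝ) : Prop :=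
  IsStationarySolution g₁ 1 ω V χ ∧ Function.Periodic χ L ∧
    ∀ x, equilibrium g₁ (ω + Vmin) ≤ χ x ∧ χ x ≤ equilibrium g₁ (ω + Vmax)

/-- `φ` is the odd profile of a dark soliton (with `g₂ = 1`) asymptotic to `±φp` at `±∞`, where `φp`
is the one and only `L`-periodic stationary solution between `ρ₁` and `ρ₂`. -/
def IsOddDarkSoliton (g₁ ω L Vmin Vmax : ℝ) (V φ : ℝ → ℝ) : Prop :=
  Function.Odd φ ∧ ∃ φp : ℝ → ℝ, IsPeriodicBackground g₁ ω L Vmin Vmax V φp ∧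
    (∀ χ : ℝ → ℝ, IsPeriodicBackground g₁ ω L Vmin Vmax V χ → χ = φp) ∧
    IsDarkSoliton g₁ 1 ω L V φ (fun x => -φp x) φp

/-- Positivity of `∂f/∂y` for `f(x,y) = y⁵ + g₁ y³ - (ω + V(x)) y` on `[0,L] × [ρ₁,ρ₂]`. -/
def MonotonicityCondition (g₁ ω L Vmin Vmax : ℝ) (V : ℝ → ℝ) : Prop :=
  ∀ x ∈ Set.Icc 0 L,
    ∀ y ∈ Set.Icc (equilibrium g₁ (ω + Vmin)) (equilibrium g₁ (ω + Vmax)),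
      0 < 5 * y ^ 4 + 3 * g₁ * y ^ 2 - (ω + V x)

/-- The explicit frequency inequality, in the cases `g₁ ≥ 0` and `g₁ < 0`. -/
def FrequencyCondition (g₁ ω Vmin Vmax : ℝ) : Prop :=
  (0 ≤ g₁ ∧ Vmax - 5 * Vmin < ω - g₁ * √(g₁ ^ 2 + 4 * ω + 4 * Vmin)) ∨
  (g₁ < 0 ∧ 0 < 8 * ω + 2 * g₁ ^ 2 + 10 * Vmin - 2 * Vmax
    - 5 * g₁ * √(4 * ω + g₁ ^ 2 + 4 * Vmin) + 3 * g₁ * √(4 * ω + g₁ ^ 2 + 4 * Vmax))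

/-- An explicit threshold frequency `ω₀`. -/
def omegaZero (g₁ Vmin Vmax : ℝ) : ℝ :=
  if 0 ≤ g₁ then
    ((2 * g₁ + √(max 0 (5 * g₁ ^ 2 + 4 * (Vmax - 4 * Vmin)))) ^ 2 - g₁ ^ 2) / 4 - Vmin
  else
    max (-Vmin) ((Vmax - 5 * Vmin - g₁ ^ 2 + 3 * |g₁| * √(Vmax - Vmin)) / 4)

end DarkSoliton

end

/-!
Write `c = ω + V`, let `ρ₁ ≤ ρ₂ = M` be the equilibria belonging to the bounds of `c`, and choose `k`
so large that `h(x, y) = k² y - (y⁵ + g y³ - c(x) y)` increases in `y` on `[-M, M]`. Bounded solutions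
of the stationary equation are the bounded fixed points of `T u = G * h(·, u)`, where
`G(x) = e^{-k|x|} / (2k)` is the Green function of `k² - d²/dx²` on the line (`green`,
`Setting.hasDerivAt_of_fixedPoint`). Since `G > 0`, the map `T` is monotone. On odd functions it acts
through the Dirichlet Green function of the half-line, which is positive too, so it is also monotone
with respect to the order on `(0, ∞)` (`green_mono_of_odd`).

Iterate `T` from `M sign x`. On `(0, ∞)` the iterates decrease, and they stay above a small kink
`η tanh(d x)`, which is a lower solution because `c` is bounded below by a positive constant
(`Setting.exists_lower`). Moreover all of them satisfy `u(x) ≤ u(x + L)` on the whole line, because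
`M sign x` does and `T` is monotone and commutes with translation by `L`. The limit `u` is therefore
an odd solution, positive on `(0, ∞)`, whose translates `u(x + nL)` increase with `n`
(`Setting.exists_odd_fixedPoint`). Their limit `w` is a positive `L`-periodic solution
(`Setting.exists_periodic_limit`), and the equation at its minimum gives `ρ₁ ≤ w`. So the periodic
background and the convergence of `u` to it come from a single construction: Dini's theorem makes the
convergence uniform on a period (`tendsto_sub_of_translates`), and the equation makes the second
derivative of `u - w` tend to zero, hence the first (`tendsto_deriv_zero_of_deriv2`).

Periodic solutions `u, v ≥ ρ₁` coincide: `y⁴ + g y²` increases on `[ρ₁, ∞)`, so that at a maximum of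
`u / v` the equation forces `u ≤ v` (`le_of_periodic_solutions`). By uniqueness and the evenness of
`V` the background is even, and the oddness of `u` carries the asymptotics over to `-∞`.

Solitons for different frequencies differ since a function that solves the stationary equation for
two frequencies vanishes identically.
-/

/-! ### The Green operator of `k² - d²/dx²` on the line -/

namespace DarkSoliton

open MeasureTheory Set

/-- Convolution with the Green function `e^{-k|x|} / (2k)` of `k² - d²/dx²` on the real line. For
bounded `f` it is the bounded solution `w` of `k² w - w'' = f`. -/
noncomputable def green (k : ℝ) (f : ℝ → ℝ) (x : ℝ) : ℝ :=
  (2 * k)⁻¹ * ∫ y, Real.exp (-(k * |x - y|)) * f y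

lemma integrable_exp_neg_abs_sub {k : ℝ} (hk : 0 < k) (x : ℝ) :
    Integrable fun y : ℝ => Real.exp (-(k * |x - y|)) := by
  rw [← integrableOn_univ, ← Iic_union_Ioi (a := x)]
  refine IntegrableOn.union ?_ ?_
  · refine IntegrableOn.congr_fun
      ((integrableOn_exp_mul_Iic hk x).const_mul (Real.exp (-(k * x)))) (fun y hy => ?_)
      measurableSet_Iic
    have hy : y ≤ x := hy
    simp only [abs_of_nonneg (sub_nonneg.2 hy), ← Real.exp_add]
    ring_nf
  · refine IntegrableOn.congr_fun
      ((integrableOn_exp_mul_Ioi (neg_lt_zero.2 hk) x).const_mul (Real.exp (k * x)))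
      (fun y hy => ?_) measurableSet_Ioi
    have hy : x < y := hy
    simp only [abs_of_neg (sub_neg.2 hy), ← Real.exp_add]
    ring_nf

lemma integrable_exp_mul {k C : ℝ} (hk : 0 < k) {f : ℝ → ℝ} (hf : Measurable f)
    (hC : ∀ y, |f y| ≤ C) (x : ℝ) :
    Integrable fun y : ℝ => Real.exp (-(k * |x - y|)) * f y :=
  (integrable_exp_neg_abs_sub hk x).mul_bdd hf.aestronglyMeasurable
    (Eventually.of_forall hC)

lemma green_mono {k C D : ℝ} (hk : 0 < k) {f g : ℝ → ℝ} (hf : Measurable f)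
    (hg : Measurable g) (hC : ∀ y, |f y| ≤ C) (hD : ∀ y, |g y| ≤ D) (h : ∀ y, f y ≤ g y) (x : ℝ) :
    green k f x ≤ green k g x := by
  refine mul_le_mul_of_nonneg_left ?_ (by positivity)
  exact integral_mono (integrable_exp_mul hk hf hC x) (integrable_exp_mul hk hg hD x)
    fun y => mul_le_mul_of_nonneg_left (h y) (Real.exp_pos _).le

lemma green_comp_add (k : ℝ) (f : ℝ → ℝ) (s x : ℝ) :
    green k (fun y => f (y + s)) x = green k f (x + s) := by
  unfold green
  rw [← integral_add_right_eq_self (fun y => Real.exp (-(k * |x + s - y|)) * f y) s]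
  simp only [add_sub_add_right_eq_sub]

lemma green_odd (k : ℝ) {f : ℝ → ℝ} (hf : Function.Odd f) : Function.Odd (green k f) := by
  intro x
  unfold green
  rw [← integral_neg_eq_self, ← mul_neg, ← integral_neg]
  congr 2
  ext y
  rw [hf, mul_neg, ← abs_neg]
  ring_nf

/-- On odd data the Green operator acts on the half-line through the Dirichlet Green function
`e^{-k|x-y|} - e^{-k(x+y)}`, which is nonnegative; hence it is monotone there. -/
lemma green_mono_of_odd {k C D : ℝ} (hk : 0 < k) {f g : ℝ → ℝ} (hf : Measurable f)
    (hg : Measurable g) (hC : ∀ y, |f y| ≤ C) (hD : ∀ y, |g y| ≤ D)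
    (hfo : Function.Odd f) (hgo : Function.Odd g) (h : ∀ y, 0 < y → f y ≤ g y) {x : ℝ}
    (hx : 0 ≤ x) : green k f x ≤ green k g x := by
  have key : 0 ≤ ∫ y, (Real.exp (-(k * |x - y|)) * g y - Real.exp (-(k * |x - y|)) * f y) -
      (Real.exp (-(k * |-x - y|)) * g y - Real.exp (-(k * |-x - y|)) * f y) := by
    refine integral_nonneg fun y => ?_
    have e : (Real.exp (-(k * |x - y|)) * g y - Real.exp (-(k * |x - y|)) * f y) -
      (Real.exp (-(k * |-x - y|)) * g y - Real.exp (-(k * |-x - y|)) * f y) =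
      (Real.exp (-(k * |x - y|)) - Real.exp (-(k * |-x - y|))) * (g y - f y) := by ring
    simp only [Pi.zero_apply]
    rw [e]
    rcases lt_trichotomy y 0 with hy | rfl | hy
    · have h1 := h (-y) (by linarith)
      rw [hfo, hgo] at h1
      refine mul_nonneg_of_nonpos_of_nonpos (sub_nonpos.2 (Real.exp_le_exp.2 ?_)) (by linarith)
      have : |-x - y| ≤ |x - y| := by
        rw [abs_of_nonneg (by linarith : 0 ≤ x - y)]
        exact abs_le.2 ⟨by linarith, by linarith⟩
      nlinarith
    · have h1 := hfo 0
      have h2 := hgo 0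
      simp only [neg_zero] at h1 h2
      rw [show g 0 - f 0 = 0 by linarith, mul_zero]
    · have h1 := h y hy
      refine mul_nonneg (sub_nonneg.2 (Real.exp_le_exp.2 ?_)) (by linarith)
      have : |x - y| ≤ |-x - y| := by
        rw [abs_of_nonpos (by linarith : -x - y ≤ 0)]
        exact abs_le.2 ⟨by linarith, by linarith⟩
      nlinarith
  have i1 := integrable_exp_mul hk hf hC
  have i2 := integrable_exp_mul hk hg hD
  have e := integral_sub ((i2 x).sub (i1 x)) ((i2 (-x)).sub (i1 (-x)))
  simp only [Pi.sub_apply] at e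
  rw [e, integral_sub (i2 x) (i1 x), integral_sub (i2 (-x)) (i1 (-x))] at key
  have of := green_odd k hfo x
  have og := green_odd k hgo x
  have hk2 : 0 < (2 * k)⁻¹ := by positivity
  have := mul_nonneg hk2.le key
  unfold green at of og ⊢
  linarith

lemma tendsto_green {k C : ℝ} (hk : 0 < k) {F : ℕ → ℝ → ℝ} {f : ℝ → ℝ}
    (hF : ∀ n, Measurable (F n)) (hC : ∀ n y, |F n y| ≤ C)
    (h : ∀ y, Tendsto (fun n => F n y) atTop (𝓝 (f y))) (x : ℝ) :
    Tendsto (fun n => green k (F n) x) atTop (𝓝 (green k f x)) := by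
  refine Tendsto.const_mul _ (tendsto_integral_of_dominated_convergence
    (fun y => Real.exp (-(k * |x - y|)) * C) (fun n => ?_)
    ((integrable_exp_neg_abs_sub hk x).mul_const C) (fun n => ?_) ?_)
  · exact (integrable_exp_mul hk (hF n) (hC n) x).aestronglyMeasurable
  · refine Eventually.of_forall fun y => ?_
    rw [norm_mul, Real.norm_eq_abs, Real.abs_exp]
    exact mul_le_mul_of_nonneg_left (hC n y) (Real.exp_pos _).le
  · exact Eventually.of_forall fun y => (h y).const_mul _

/-- The Green operator written with primitives of `f` against the two exponential solutions of
`w'' = k² w`. -/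
lemma green_eq {k C : ℝ} (hk : 0 < k) {f : ℝ → ℝ} (hf : Measurable f) (hC : ∀ y, |f y| ≤ C) :
    ∃ A B : ℝ, ∀ x, green k f x = (2 * k)⁻¹ *
      (Real.exp (-(k * x)) * (A + ∫ y in (0 : ℝ)..x, Real.exp (k * y) * f y) +
        Real.exp (k * x) * (B - ∫ y in (0 : ℝ)..x, Real.exp (-(k * y)) * f y)) := by
  have hA : ∀ x, IntegrableOn (fun y => Real.exp (k * y) * f y) (Iic x) := fun x =>
    (integrableOn_exp_mul_Iic hk x).mul_bdd hf.aestronglyMeasurable (Eventually.of_forall hC)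
  have hB : ∀ x, IntegrableOn (fun y => Real.exp (-(k * y)) * f y) (Ioi x) := fun x => by
    simp only [← neg_mul]
    exact (integrableOn_exp_mul_Ioi (neg_lt_zero.2 hk) x).mul_bdd hf.aestronglyMeasurable
      (Eventually.of_forall hC)
  refine ⟨∫ y in Iic 0, Real.exp (k * y) * f y, ∫ y in Ioi 0, Real.exp (-(k * y)) * f y,
    fun x => ?_⟩
  rw [← intervalIntegral.integral_Iic_sub_Iic (hA 0) (hA x),
    ← intervalIntegral.integral_Ioi_sub_Ioi' (hB 0) (hB x), add_sub_cancel, sub_sub_cancel,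
    ← integral_const_mul, ← integral_const_mul]
  unfold green
  have hi := integrable_exp_mul hk hf hC x
  rw [← intervalIntegral.integral_Iic_add_Ioi hi.integrableOn hi.integrableOn]
  congr 2
  · refine setIntegral_congr_fun measurableSet_Iic fun y hy => ?_
    have hy : y ≤ x := hy
    simp only [abs_of_nonneg (sub_nonneg.2 hy), ← mul_assoc, ← Real.exp_add]
    ring_nf
  · refine setIntegral_congr_fun measurableSet_Ioi fun y hy => ?_
    have hy : x < y := hy
    simp only [abs_of_neg (sub_neg.2 hy), ← mul_assoc, ← Real.exp_add]
    ring_nf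

lemma continuous_green {k C : ℝ} (hk : 0 < k) {f : ℝ → ℝ} (hf : Measurable f)
    (hC : ∀ y, |f y| ≤ C) : Continuous (green k f) := by
  obtain ⟨A, B, h⟩ := green_eq hk hf hC
  have hint : ∀ {e : ℝ → ℝ}, Continuous e → ∀ a b : ℝ,
      IntervalIntegrable (fun y => e y * f y) volume a b := fun {e} he a b => by
    rw [intervalIntegrable_iff]
    exact ((he.intervalIntegrable a b).def').mul_bdd hf.aestronglyMeasurable
      (Eventually.of_forall hC)
  have h1 := intervalIntegral.continuous_primitive
    (hint (e := fun y => Real.exp (k * y)) (by fun_prop)) 0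
  have h2 := intervalIntegral.continuous_primitive
    (hint (e := fun y => Real.exp (-(k * y))) (by fun_prop)) 0
  rw [show green k f = _ from funext h]
  fun_prop

lemma hasDerivAt_green {k C : ℝ} (hk : 0 < k) {f : ℝ → ℝ} (hf : Continuous f)
    (hC : ∀ y, |f y| ≤ C) : ∃ w' : ℝ → ℝ, (∀ x, HasDerivAt (green k f) (w' x) x) ∧
      ∀ x, HasDerivAt w' (k ^ 2 * green k f x - f x) x := by
  obtain ⟨A, B, h⟩ := green_eq hk hf.measurable hC
  have hI : ∀ {e : ℝ → ℝ}, Continuous e → ∀ x : ℝ,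
      HasDerivAt (fun x => ∫ y in (0 : ℝ)..x, e y * f y) (e x * f x) x := fun {e} he x =>
    (he.mul hf).integral_hasStrictDerivAt 0 x |>.hasDerivAt
  have h1 := fun x => (hI (e := fun y => Real.exp (k * y)) (by fun_prop) x).const_add A
  have h2 := fun x => (hI (e := fun y => Real.exp (-(k * y))) (by fun_prop) x).const_sub B
  have e1 : ∀ x : ℝ, HasDerivAt (fun x => Real.exp (-(k * x))) (Real.exp (-(k * x)) * (-k)) x :=
    fun x => by simpa using ((hasDerivAt_id x).const_mul k).neg.exp
  have e2 : ∀ x : ℝ, HasDerivAt (fun x => Real.exp (k * x)) (Real.exp (k * x) * k) x :=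
    fun x => by simpa using ((hasDerivAt_id x).const_mul k).exp
  have ee : ∀ x : ℝ, Real.exp (-(k * x)) * Real.exp (k * x) = 1 := fun x => by
    rw [← Real.exp_add]; simp
  refine ⟨fun x => (2 * k)⁻¹ *
      (Real.exp (-(k * x)) * (-k) * (A + ∫ y in (0 : ℝ)..x, Real.exp (k * y) * f y) +
        Real.exp (k * x) * k * (B - ∫ y in (0 : ℝ)..x, Real.exp (-(k * y)) * f y)),
    fun x => ?_, fun x => ?_⟩
  · rw [show green k f = _ from funext h]
    refine ((((e1 x).mul (h1 x)).add ((e2 x).mul (h2 x))).const_mul (2 * k)⁻¹).congr_deriv ?_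
    ring
  · rw [h x]
    refine (((((e1 x).mul_const (-k)).mul (h1 x)).add
      (((e2 x).mul_const k).mul (h2 x))).const_mul (2 * k)⁻¹).congr_deriv ?_
    field_simp
    linear_combination (-2 * f x) * ee x

lemma abs_green_le {k C : ℝ} (hk : 0 < k) {f : ℝ → ℝ} (hC : ∀ y, |f y| ≤ C) :
    ∃ D, ∀ x, |green k f x| ≤ D := by
  refine ⟨(2 * k)⁻¹ * ∫ y, Real.exp (-(k * |y|)) * C, fun x => ?_⟩
  unfold green
  rw [abs_mul, abs_of_pos (by positivity : 0 < (2 * k)⁻¹)]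
  refine mul_le_mul_of_nonneg_left ?_ (by positivity)
  have e : ∫ y, Real.exp (-(k * |y|)) * C = ∫ y, Real.exp (-(k * |x - y|)) * C :=
    (integral_sub_left_eq_self (fun y => Real.exp (-(k * |y|)) * C) volume x).symm
  rw [e]
  refine norm_integral_le_of_norm_le (G := ℝ) ((integrable_exp_neg_abs_sub hk x).mul_const C)
    (Eventually.of_forall fun y => ?_)
  rw [norm_mul, Real.norm_eq_abs, Real.abs_exp]
  exact mul_le_mul_of_nonneg_left (hC y) (Real.exp_pos _).le

/-- The only bounded solution of `z'' = k² z` on the line is zero. -/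
lemma eq_zero_of_bounded_of_deriv2 {k D : ℝ} (hk : 0 < k) {z z' : ℝ → ℝ}
    (h1 : ∀ x, HasDerivAt z (z' x) x) (h2 : ∀ x, HasDerivAt z' (k ^ 2 * z x) x)
    (hD : ∀ x, |z x| ≤ D) (x : ℝ) : z x = 0 := by
  have e1 : ∀ x : ℝ, HasDerivAt (fun x => Real.exp (-(k * x))) (Real.exp (-(k * x)) * (-k)) x :=
    fun x => by simpa using ((hasDerivAt_id x).const_mul k).neg.exp
  have e2 : ∀ x : ℝ, HasDerivAt (fun x => Real.exp (k * x)) (Real.exp (k * x) * k) x :=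
    fun x => by simpa using ((hasDerivAt_id x).const_mul k).exp
  have ee : ∀ x : ℝ, Real.exp (-(k * x)) * Real.exp (k * x) = 1 := fun x => by
    rw [← Real.exp_add]; simp
  -- the coordinates of `z` in the basis of exponential solutions are constant
  have c1 : ∀ x, Real.exp (-(k * x)) * (z' x + k * z x) = z' 0 + k * z 0 := fun x => by
    have hd : ∀ x, HasDerivAt (fun x => Real.exp (-(k * x)) * (z' x + k * z x)) 0 x := fun x => by
      refine ((e1 x).mul ((h2 x).add ((h1 x).const_mul k))).congr_deriv ?_
      simp only [Pi.add_apply]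
      ring
    have := is_const_of_deriv_eq_zero (fun x => (hd x).differentiableAt) (fun x => (hd x).deriv) x 0
    simpa using this
  have c2 : ∀ x, Real.exp (k * x) * (z' x - k * z x) = z' 0 - k * z 0 := fun x => by
    have hd : ∀ x, HasDerivAt (fun x => Real.exp (k * x) * (z' x - k * z x)) 0 x := fun x => by
      refine ((e2 x).mul ((h2 x).sub ((h1 x).const_mul k))).congr_deriv ?_
      simp only [Pi.sub_apply]
      ring
    have := is_const_of_deriv_eq_zero (fun x => (hd x).differentiableAt) (fun x => (hd x).deriv) x 0
    simpa using this
  have rep : ∀ x, 2 * k * z x = Real.exp (k * x) * (z' 0 + k * z 0) -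
      Real.exp (-(k * x)) * (z' 0 - k * z 0) := fun x => by
    rw [← c1 x, ← c2 x]
    linear_combination (-2 * k * z x) * ee x
  have bd : ∀ P Q E : ℝ, (∀ x, 0 ≤ x → |Real.exp (k * x) * P - Real.exp (-(k * x)) * Q| ≤ E) →
      P = 0 := fun P Q E hE => by
    by_contra hP
    have hlim : Tendsto (fun x : ℝ => Real.exp (k * x) * |P|) atTop atTop :=
      (Real.tendsto_exp_atTop.comp (tendsto_id.const_mul_atTop hk)).atTop_mul_const
        (abs_pos.2 hP)
    obtain ⟨x, hx, hx0⟩ := ((hlim.eventually_gt_atTop (E + |Q|)).and (eventually_ge_atTop 0)).exists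
    have h3 := hE x hx0
    have h4 : |Real.exp (-(k * x)) * Q| ≤ |Q| := by
      rw [abs_mul, Real.abs_exp]
      exact mul_le_of_le_one_left (abs_nonneg _) (Real.exp_le_one_iff.2 (by nlinarith))
    have h5 := abs_sub_abs_le_abs_sub (Real.exp (k * x) * P) (Real.exp (-(k * x)) * Q)
    rw [abs_mul (Real.exp (k * x)), Real.abs_exp] at h5
    linarith
  have hb : ∀ x, |2 * k * z x| ≤ 2 * k * D := fun x => by
    rw [abs_mul, abs_of_pos (by positivity : 0 < 2 * k)]
    exact mul_le_mul_of_nonneg_left (hD x) (by positivity)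
  have p0 := bd _ _ _ fun x _ => (rep x) ▸ hb x
  have q0 := bd (-(z' 0 - k * z 0)) (-(z' 0 + k * z 0)) (2 * k * D) fun x _ => by
    have := hb (-x)
    rw [rep] at this
    convert this using 2
    ring_nf
  have := rep x
  rw [p0, neg_eq_zero.1 q0] at this
  have hk2 : 2 * k ≠ 0 := by positivity
  simpa [hk.ne'] using this

/-- A bounded function is recovered from `k² v - v''` by the Green operator. -/
lemma green_sub_deriv2 {k C D : ℝ} (hk : 0 < k) {v v' v'' : ℝ → ℝ}
    (h1 : ∀ x, HasDerivAt v (v' x) x) (h2 : ∀ x, HasDerivAt v' (v'' x) x) (hv'' : Continuous v'')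
    (hD : ∀ x, |v x| ≤ D) (hC : ∀ x, |k ^ 2 * v x - v'' x| ≤ C) (x : ℝ) :
    green k (fun y => k ^ 2 * v y - v'' y) x = v x := by
  have hv : Continuous v := continuous_iff_continuousAt.2 fun x => (h1 x).continuousAt
  obtain ⟨w', g1, g2⟩ := hasDerivAt_green hk
    (f := fun y => k ^ 2 * v y - v'' y) (by fun_prop) hC
  obtain ⟨E, hE⟩ := abs_green_le hk hC
  refine sub_eq_zero.1 (eq_zero_of_bounded_of_deriv2 hk (D := E + D)
    (fun x => (g1 x).sub (h1 x)) (fun x => ?_) (fun x => ?_) x)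
  · refine ((g2 x).sub (h2 x)).congr_deriv ?_
    simp only [Pi.sub_apply]
    ring
  · exact (abs_sub _ _).trans (add_le_add (hE x) (hD x))

/-! ### The shifted nonlinearity -/

/-- `k² y - (y⁵ + g y³ - c y)`: minus the force of the stationary equation, shifted by `k² y`. -/
def shiftedForce (g k c y : ℝ) : ℝ := k ^ 2 * y + c * y - g * y ^ 3 - y ^ 5

/-- The map whose fixed points are the bounded solutions of the stationary equation with
coefficient `c = ω + V`. -/
noncomputable def fixedPointMap (g k : ℝ) (c u : ℝ → ℝ) : ℝ → ℝ :=
  green k fun y => shiftedForce g k (c y) (u y)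

/-- The hypotheses on `c = ω + V`, with `M` the equilibrium at the level of the upper bound `b`, and
`k` so large that the shifted nonlinearity is monotone on `[-M, M]`. -/
structure Setting (g L a b M k : ℝ) (c : ℝ → ℝ) : Prop where
  L_pos : 0 < L
  a_pos : 0 < a
  M_pos : 0 < M
  M_eq : M ^ 4 + g * M ^ 2 = b
  k_eq : k = 1 + 3 * |g| * M ^ 2 + 5 * M ^ 4
  cont : Continuous c
  periodic : Function.Periodic c L
  even : Function.Even c
  le_c : ∀ x, a ≤ c x
  c_le : ∀ x, c x ≤ b

/-- A bound for the difference quotient of `y ↦ y⁵ + g y³` on `[-M, M]`. -/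
lemma abs_power_quotient_le {g M x y : ℝ} (hx : |x| ≤ M) (hy : |y| ≤ M) :
    |g * (x ^ 2 + x * y + y ^ 2) + (x ^ 4 + x ^ 3 * y + x ^ 2 * y ^ 2 + x * y ^ 3 + y ^ 4)| ≤
      3 * |g| * M ^ 2 + 5 * M ^ 4 := by
  have hM : 0 ≤ M := (abs_nonneg x).trans hx
  have m : ∀ i j : ℕ, |x ^ i * y ^ j| ≤ M ^ (i + j) := fun i j => by
    rw [abs_mul, abs_pow, abs_pow, pow_add]
    gcongr
  have t2 := m 2 0
  have t1 := m 1 1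
  have t0 := m 0 2
  have q4 := m 4 0
  have q3 := m 3 1
  have q2 := m 2 2
  have q1 := m 1 3
  have q0 := m 0 4
  norm_num only [pow_zero, pow_one, mul_one, one_mul] at t2 t1 t0 q4 q3 q2 q1 q0
  have hq : |x ^ 2 + x * y + y ^ 2| ≤ 3 * M ^ 2 := by
    rw [abs_le] at *
    constructor <;> linarith
  have hr : |x ^ 4 + x ^ 3 * y + x ^ 2 * y ^ 2 + x * y ^ 3 + y ^ 4| ≤ 5 * M ^ 4 := by
    rw [abs_le] at *
    constructor <;> linarith
  refine (abs_add_le _ _).trans (add_le_add ?_ hr)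
  rw [abs_mul]
  calc |g| * |x ^ 2 + x * y + y ^ 2| ≤ |g| * (3 * M ^ 2) := by gcongr
    _ = 3 * |g| * M ^ 2 := by ring

lemma shiftedForce_neg (g k c y : ℝ) : shiftedForce g k c (-y) = -shiftedForce g k c y := by
  unfold shiftedForce; ring

lemma shiftedForce_mono {g k c M x y : ℝ} (hk : 3 * |g| * M ^ 2 + 5 * M ^ 4 ≤ k ^ 2)
    (hc : 0 ≤ c) (hx : |x| ≤ M) (hy : |y| ≤ M) (hxy : x ≤ y) :
    shiftedForce g k c x ≤ shiftedForce g k c y := by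
  have h := (abs_le.1 (abs_power_quotient_le (g := g) hx hy)).2
  have : shiftedForce g k c y - shiftedForce g k c x = (y - x) * (k ^ 2 + c -
    (g * (x ^ 2 + x * y + y ^ 2) + (x ^ 4 + x ^ 3 * y + x ^ 2 * y ^ 2 + x * y ^ 3 + y ^ 4))) := by
    unfold shiftedForce; ring
  have h2 : 0 ≤ shiftedForce g k c y - shiftedForce g k c x := by
    rw [this]
    exact mul_nonneg (by linarith) (by linarith)
  linarith

variable {g L a b M k : ℝ} {c : ℝ → ℝ}

namespace Setting

lemma k_pos (S : Setting g L a b M k c) : 0 < k := by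
  rw [S.k_eq]; positivity

lemma k_sq (S : Setting g L a b M k c) : 3 * |g| * M ^ 2 + 5 * M ^ 4 ≤ k ^ 2 := by
  have h : 0 ≤ 3 * |g| * M ^ 2 + 5 * M ^ 4 := by positivity
  nlinarith [S.k_eq]

lemma mono (S : Setting g L a b M k c) (y : ℝ) {p q : ℝ} (hp : |p| ≤ M) (hq : |q| ≤ M)
    (h : p ≤ q) : shiftedForce g k (c y) p ≤ shiftedForce g k (c y) q :=
  shiftedForce_mono S.k_sq (S.a_pos.le.trans (S.le_c y)) hp hq h

/-- The constant `M` is an upper solution. -/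
lemma shiftedForce_le (S : Setting g L a b M k c) (y : ℝ) {p : ℝ} (hp : |p| ≤ M) :
    shiftedForce g k (c y) p ≤ k ^ 2 * M := by
  refine (S.mono y hp (abs_of_pos S.M_pos).le (abs_le.1 hp).2).trans ?_
  have : shiftedForce g k (c y) M = k ^ 2 * M + M * (c y - (M ^ 4 + g * M ^ 2)) := by
    unfold shiftedForce; ring
  rw [this, S.M_eq]
  nlinarith [S.c_le y, S.M_pos]

lemma abs_shiftedForce_le (S : Setting g L a b M k c) (y : ℝ) {p : ℝ} (hp : |p| ≤ M) :
    |shiftedForce g k (c y) p| ≤ k ^ 2 * M := by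
  refine abs_le.2 ⟨?_, S.shiftedForce_le y hp⟩
  have := S.shiftedForce_le y (p := -p) (by rwa [abs_neg])
  rw [shiftedForce_neg] at this
  linarith

lemma measurable_shiftedForce (S : Setting g L a b M k c) {u : ℝ → ℝ} (hu : Measurable u) :
    Measurable fun y => shiftedForce g k (c y) (u y) := by
  have := S.cont.measurable
  unfold shiftedForce
  fun_prop

lemma odd_shiftedForce (S : Setting g L a b M k c) {u : ℝ → ℝ} (hu : Function.Odd u) :
    Function.Odd fun y => shiftedForce g k (c y) (u y) := fun y => by
  simp only
  rw [S.even, hu, shiftedForce_neg]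

lemma fixedPointMap_le (S : Setting g L a b M k c) {u : ℝ → ℝ} (hu : Measurable u)
    (hM : ∀ y, |u y| ≤ M) (x : ℝ) : fixedPointMap g k c u x ≤ M := by
  have h := green_mono S.k_pos (S.measurable_shiftedForce hu)
    (measurable_const (a := k ^ 2 * M - 0)) (fun y => S.abs_shiftedForce_le y (hM y))
    (fun _ => le_rfl) (fun y => by simpa using S.shiftedForce_le y (hM y)) x
  rwa [green_sub_deriv2 (v := fun _ => M) (v' := fun _ => 0) (v'' := fun _ => 0) S.k_pos
    (fun x => hasDerivAt_const x M) (fun x => hasDerivAt_const x 0) continuous_const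
    (fun _ => le_rfl) (fun _ => le_rfl)] at h

lemma fixedPointMap_shift (S : Setting g L a b M k c) (u : ℝ → ℝ) (n : ℕ) (x : ℝ) :
    fixedPointMap g k c (fun y => u (y + n * L)) x = fixedPointMap g k c u (x + n * L) := by
  unfold fixedPointMap
  rw [← green_comp_add]
  congr 1
  ext y
  rw [S.periodic.nat_mul n y]

lemma tendsto_fixedPointMap (S : Setting g L a b M k c) {U : ℕ → ℝ → ℝ} {u : ℝ → ℝ}
    (hU : ∀ n, Measurable (U n)) (hM : ∀ n y, |U n y| ≤ M)
    (h : ∀ y, Tendsto (fun n => U n y) atTop (𝓝 (u y))) (x : ℝ) :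
    Tendsto (fun n => fixedPointMap g k c (U n) x) atTop (𝓝 (fixedPointMap g k c u x)) := by
  refine tendsto_green S.k_pos (fun n => S.measurable_shiftedForce (hU n))
    (fun n y => S.abs_shiftedForce_le y (hM n y)) (fun y => ?_) x
  have hc : Continuous fun p => shiftedForce g k (c y) p := by
    unfold shiftedForce; fun_prop
  exact (hc.tendsto _).comp (h y)

/-- Bounded measurable fixed points are classical solutions of the stationary equation. -/
lemma hasDerivAt_of_fixedPoint (S : Setting g L a b M k c) {u : ℝ → ℝ} (hu : Measurable u)
    (hM : ∀ y, |u y| ≤ M) (hfix : ∀ x, fixedPointMap g k c u x = u x) :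
    ∃ u' : ℝ → ℝ, (∀ x, HasDerivAt u (u' x) x) ∧
      ∀ x, HasDerivAt u' (u x ^ 5 + g * u x ^ 3 - c x * u x) x := by
  have hfix' : fixedPointMap g k c u = u := funext hfix
  have hcont : Continuous u := by
    rw [← hfix']
    exact continuous_green S.k_pos (S.measurable_shiftedForce hu)
      fun y => S.abs_shiftedForce_le y (hM y)
  obtain ⟨u', h1, h2⟩ := hasDerivAt_green S.k_pos (f := fun y => shiftedForce g k (c y) (u y))
    (by have := S.cont; unfold shiftedForce; fun_prop) fun y => S.abs_shiftedForce_le y (hM y)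
  change ∀ x, HasDerivAt (fixedPointMap g k c u) _ _ at h1
  change ∀ x, HasDerivAt u' (k ^ 2 * fixedPointMap g k c u x - _) _ at h2
  rw [hfix'] at h1 h2
  refine ⟨u', h1, fun x => (h2 x).congr_deriv ?_⟩
  unfold shiftedForce
  ring

end Setting

/-! ### The lower solution -/

lemma hasDerivAt_tanh (x : ℝ) : HasDerivAt Real.tanh (1 - Real.tanh x ^ 2) x := by
  have h0 : Real.cosh x ≠ 0 := (Real.cosh_pos x).ne'
  have e : Real.tanh = fun x => Real.sinh x / Real.cosh x :=
    funext Real.tanh_eq_sinh_div_cosh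
  rw [e]
  refine ((Real.hasDerivAt_sinh x).div (Real.hasDerivAt_cosh x) h0).congr_deriv ?_
  field_simp

lemma tanh_sq_lt_one (x : ℝ) : Real.tanh x ^ 2 < 1 := by
  have h0 : 0 < Real.cosh x := Real.cosh_pos x
  rw [Real.tanh_eq_sinh_div_cosh, div_pow, div_lt_one (by positivity), Real.sinh_sq]
  linarith

lemma tanh_pos {x : ℝ} (hx : 0 < x) : 0 < Real.tanh x := by
  rw [Real.tanh_eq_sinh_div_cosh]
  exact div_pos (Real.sinh_pos_iff.2 hx) (Real.cosh_pos x)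

namespace Setting

/-- A small, slowly varying kink `η tanh(d x)` is an odd function that is a lower solution of the
stationary equation on the half-line. -/
lemma exists_lower (S : Setting g L a b M k c) : ∃ α : ℝ → ℝ, Measurable α ∧ Function.Odd α ∧
    (∀ x, |α x| ≤ M) ∧ (∀ x, 0 < x → 0 < α x) ∧
    ∀ x, 0 < x → α x ≤ fixedPointMap g k c α x := by
  obtain ⟨d, hd0, hd⟩ : ∃ d : ℝ, 0 < d ∧ 2 * d ^ 2 ≤ a / 2 := by
    refine ⟨min 1 (a / 4), lt_min one_pos (by linarith [S.a_pos]), ?_⟩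
    have h1 := min_le_left 1 (a / 4)
    have h2 := min_le_right 1 (a / 4)
    have h3 : 0 < min 1 (a / 4) := lt_min one_pos (by linarith [S.a_pos])
    nlinarith
  obtain ⟨η, hη0, hηM, hη⟩ : ∃ η : ℝ, 0 < η ∧ η ≤ M ∧ η ^ 4 + |g| * η ^ 2 ≤ a / 2 := by
    have hg : 0 < 2 * (1 + |g|) := by positivity
    have h0 : 0 < min (min 1 M) (a / (2 * (1 + |g|))) :=
      lt_min (lt_min one_pos S.M_pos) (div_pos S.a_pos hg)
    have h1 := (min_le_left (min 1 M) (a / (2 * (1 + |g|)))).trans (min_le_left _ _)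
    have h2 := (min_le_left (min 1 M) (a / (2 * (1 + |g|)))).trans (min_le_right _ _)
    have h3 := min_le_right (min 1 M) (a / (2 * (1 + |g|)))
    generalize min (min 1 M) (a / (2 * (1 + |g|))) = η at h0 h1 h2 h3
    refine ⟨η, h0, h2, ?_⟩
    rw [le_div_iff₀ hg] at h3
    have h4 : η ^ 4 ≤ η := pow_le_of_le_one h0.le h1 (by norm_num)
    have h5 : η ^ 2 ≤ η := pow_le_of_le_one h0.le h1 (by norm_num)
    nlinarith [mul_le_mul_of_nonneg_left h5 (abs_nonneg g)]
  set τ : ℝ → ℝ := fun x => Real.tanh (d * x) with hτ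
  have hτ1 : ∀ x, HasDerivAt τ (d * (1 - τ x ^ 2)) x := fun x => by
    have := (hasDerivAt_tanh (d * x)).comp x ((hasDerivAt_id x).const_mul d)
    refine this.congr_deriv ?_
    simp only [hτ]
    ring
  have hτ2 : ∀ x, τ x ^ 2 < 1 := fun x => tanh_sq_lt_one _
  have hτa : ∀ x, |τ x| ≤ 1 := fun x => abs_le_of_sq_le_sq (by simpa using (hτ2 x).le) zero_le_one
  have hτp : ∀ x, 0 < x → 0 < τ x := fun x hx => tanh_pos (mul_pos hd0 hx)
  have hτo : Function.Odd τ := fun x => by simp [hτ]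
  have hτc : Continuous τ := continuous_iff_continuousAt.2 fun x => (hτ1 x).continuousAt
  have hαM : ∀ x, |η * τ x| ≤ M := fun x => by
    rw [abs_mul, abs_of_pos hη0]
    nlinarith [hτa x]
  have h1 : ∀ x, HasDerivAt (fun x => η * τ x) (η * (d * (1 - τ x ^ 2))) x :=
    fun x => (hτ1 x).const_mul η
  have h2 : ∀ x, HasDerivAt (fun x => η * (d * (1 - τ x ^ 2)))
      (-(2 * d ^ 2 * η * τ x * (1 - τ x ^ 2))) x := fun x => by
    refine (((((hτ1 x).pow 2).const_sub 1).const_mul d).const_mul η).congr_deriv ?_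
    push_cast
    ring
  have hodd : Function.Odd fun x => η * τ x := fun x => by simp only; rw [hτo x]; ring
  have hC : ∀ x, |k ^ 2 * (η * τ x) - -(2 * d ^ 2 * η * τ x * (1 - τ x ^ 2))| ≤
      k ^ 2 * η + 2 * d ^ 2 * η := fun x => by
    have e : k ^ 2 * (η * τ x) - -(2 * d ^ 2 * η * τ x * (1 - τ x ^ 2)) =
      (k ^ 2 * η + 2 * d ^ 2 * η * (1 - τ x ^ 2)) * τ x := by ring
    have h3 := hτ2 x
    have h4 : 0 ≤ k ^ 2 * η + 2 * d ^ 2 * η * (1 - τ x ^ 2) :=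
      add_nonneg (by positivity) (mul_nonneg (by positivity) (by linarith))
    rw [e, abs_mul, abs_of_nonneg h4]
    refine (mul_le_of_le_one_right h4 (hτa x)).trans ?_
    have : 0 ≤ 2 * d ^ 2 * η * τ x ^ 2 := by positivity
    linarith
  refine ⟨fun x => η * τ x, by fun_prop, hodd, hαM, fun x hx => mul_pos hη0 (hτp x hx),
    fun x hx => ?_⟩
  have key := green_sub_deriv2 S.k_pos h1 h2 (by fun_prop) hαM hC x
  simp only at key ⊢
  rw [← key]
  refine green_mono_of_odd S.k_pos (by fun_prop)
    (S.measurable_shiftedForce (u := fun x => η * τ x) (by fun_prop)) hC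
    (fun y => S.abs_shiftedForce_le y (hαM y)) (fun y => ?_) (S.odd_shiftedForce hodd)
    (fun y hy => ?_) hx.le
  · simp only
    rw [hτo y]; ring
  · have e : shiftedForce g k (c y) (η * τ y) -
        (k ^ 2 * (η * τ y) - -(2 * d ^ 2 * η * τ y * (1 - τ y ^ 2))) = η * τ y *
        (c y - g * η ^ 2 * τ y ^ 2 - η ^ 4 * τ y ^ 4 - 2 * d ^ 2 * (1 - τ y ^ 2)) := by
      unfold shiftedForce; ring
    refine sub_nonneg.1 ?_
    rw [e]
    refine mul_nonneg (mul_pos hη0 (hτp y hy)).le ?_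
    have t2 := hτ2 y
    have t0 : 0 ≤ τ y ^ 2 := sq_nonneg _
    have b1 : g * η ^ 2 * τ y ^ 2 ≤ |g| * η ^ 2 := by
      have : g * η ^ 2 ≤ |g| * η ^ 2 := by gcongr; exact le_abs_self g
      calc g * η ^ 2 * τ y ^ 2 ≤ |g| * η ^ 2 * τ y ^ 2 := by gcongr
        _ ≤ |g| * η ^ 2 := mul_le_of_le_one_right (by positivity) t2.le
    have b2 : η ^ 4 * τ y ^ 4 ≤ η ^ 4 :=
      mul_le_of_le_one_right (by positivity) (by nlinarith)
    have b3 : 2 * d ^ 2 * (1 - τ y ^ 2) ≤ 2 * d ^ 2 :=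
      mul_le_of_le_one_right (by positivity) (by linarith)
    linarith [S.le_c y]

end Setting

/-! ### Monotone iteration -/

/-- The class of odd functions on which the monotone iteration runs: bounded by `M`, above the lower
solution `α` on the half-line, and not decreasing under translation by a period. -/
structure IsIterate (L M : ℝ) (α u : ℝ → ℝ) : Prop where
  measurable : Measurable u
  odd : Function.Odd u
  bound : ∀ y, |u y| ≤ M
  shift : ∀ y, u y ≤ u (y + L)
  lower : ∀ y, 0 < y → α y ≤ u y

namespace Setting

lemma fixedPointMap_mono_of_odd (S : Setting g L a b M k c) {u v : ℝ → ℝ} (hu : Measurable u)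
    (hv : Measurable v) (hou : Function.Odd u) (hov : Function.Odd v) (hMu : ∀ y, |u y| ≤ M)
    (hMv : ∀ y, |v y| ≤ M) (h : ∀ y, 0 < y → u y ≤ v y) {x : ℝ} (hx : 0 < x) :
    fixedPointMap g k c u x ≤ fixedPointMap g k c v x :=
  green_mono_of_odd S.k_pos (S.measurable_shiftedForce hu) (S.measurable_shiftedForce hv)
    (fun y => S.abs_shiftedForce_le y (hMu y)) (fun y => S.abs_shiftedForce_le y (hMv y))
    (S.odd_shiftedForce hou) (S.odd_shiftedForce hov)
    (fun y hy => S.mono y (hMu y) (hMv y) (h y hy)) hx.le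

lemma isIterate_fixedPointMap (S : Setting g L a b M k c) {α u : ℝ → ℝ} (hα : Measurable α)
    (hαo : Function.Odd α) (hαM : ∀ y, |α y| ≤ M)
    (hαT : ∀ x, 0 < x → α x ≤ fixedPointMap g k c α x) (hu : IsIterate L M α u) :
    IsIterate L M α (fixedPointMap g k c u) where
  measurable := (continuous_green S.k_pos (S.measurable_shiftedForce hu.measurable)
    fun y => S.abs_shiftedForce_le y (hu.bound y)).measurable
  odd := green_odd k (S.odd_shiftedForce hu.odd)
  bound y := by
    refine abs_le.2 ⟨?_, S.fixedPointMap_le hu.measurable hu.bound y⟩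
    have h := S.fixedPointMap_le hu.measurable hu.bound (-y)
    have ho : fixedPointMap g k c u (-y) = -fixedPointMap g k c u y :=
      green_odd k (S.odd_shiftedForce hu.odd) y
    linarith
  shift y := by
    have h := S.fixedPointMap_shift u 1 y
    simp only [Nat.cast_one, one_mul] at h
    rw [← h]
    have hm := hu.measurable
    exact green_mono S.k_pos (S.measurable_shiftedForce hm)
      (S.measurable_shiftedForce (u := fun y => u (y + L)) (by fun_prop))
      (fun y => S.abs_shiftedForce_le y (hu.bound y))
      (fun y => S.abs_shiftedForce_le y (hu.bound (y + L)))
      (fun y => S.mono y (hu.bound y) (hu.bound (y + L)) (hu.shift y)) y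
  lower y hy := (hαT y hy).trans <| S.fixedPointMap_mono_of_odd hα hu.measurable hαo hu.odd hαM
    hu.bound hu.lower hy

/-- There is an odd solution, positive on the half-line, whose translates by periods increase. -/
lemma exists_odd_fixedPoint (S : Setting g L a b M k c) : ∃ u : ℝ → ℝ, Measurable u ∧
    Function.Odd u ∧ (∀ y, |u y| ≤ M) ∧ (∀ y, u y ≤ u (y + L)) ∧ (∀ y, 0 < y → 0 < u y) ∧
    ∀ x, fixedPointMap g k c u x = u x := by
  obtain ⟨α, hα, hαo, hαM, hαp, hαT⟩ := S.exists_lower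
  set T := fixedPointMap g k c with hT
  -- the iteration starts from the upper solution `M`, extended oddly; as a monotone function it does
  -- not decrease under translation
  set u₀ : ℝ → ℝ := fun x => if x < 0 then -M else if 0 < x then M else 0 with hu₀
  have hM := S.M_pos
  have mono₀ : Monotone u₀ := fun x y hxy => by
    simp only [hu₀]
    split_ifs <;> linarith
  have i₀ : IsIterate L M α u₀ := by
    refine ⟨mono₀.measurable, fun x => ?_, fun x => ?_, fun x => mono₀ (by linarith [S.L_pos]),
      fun x hx => ?_⟩
    · simp only [hu₀]
      split_ifs <;> linarith
    · simp only [hu₀]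
      split_ifs <;> simp [abs_of_pos hM, hM.le]
    · simp only [hu₀, if_neg hx.not_gt, if_pos hx]
      exact (abs_le.1 (hαM x)).2
  have it : ∀ n, IsIterate L M α (T^[n] u₀) := fun n => by
    induction n with
    | zero => exact i₀
    | succ n ih =>
      rw [Function.iterate_succ_apply']
      exact S.isIterate_fixedPointMap hα hαo hαM hαT ih
  have anti : ∀ n x, 0 < x → (T^[n + 1] u₀) x ≤ (T^[n] u₀) x := fun n => by
    induction n with
    | zero =>
      intro x hx
      have : (T^[0] u₀) x = M := by simp [hu₀, hx, hx.not_gt]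
      rw [this]
      exact (abs_le.1 ((it 1).bound x)).2
    | succ n ih =>
      intro x hx
      have h := S.fixedPointMap_mono_of_odd (it _).measurable (it _).measurable (it _).odd (it _).odd
        (it _).bound (it _).bound ih hx
      simpa only [Function.iterate_succ_apply'] using h
  have limpos : ∀ x, 0 < x → ∃ l, Tendsto (fun n => (T^[n] u₀) x) atTop (𝓝 l) := fun x hx =>
    ⟨_, tendsto_atTop_ciInf (antitone_nat_of_succ_le fun n => anti n x hx)
      ⟨-M, by rintro _ ⟨n, rfl⟩; exact (abs_le.1 ((it n).bound x)).1⟩⟩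
  have lim : ∀ x, ∃ l, Tendsto (fun n => (T^[n] u₀) x) atTop (𝓝 l) := fun x => by
    rcases lt_trichotomy x 0 with hx | rfl | hx
    · obtain ⟨l, hl⟩ := limpos (-x) (by linarith)
      refine ⟨-l, hl.neg.congr fun n => ?_⟩
      rw [(it n).odd, neg_neg]
    · refine ⟨0, tendsto_const_nhds.congr fun n => ?_⟩
      have := (it n).odd 0
      rw [neg_zero] at this
      linarith
    · exact limpos x hx
  choose u hu using lim
  refine ⟨u, measurable_of_tendsto_metrizable (fun n => (it n).measurable)
    (tendsto_pi_nhds.2 hu), fun x => ?_, fun x => ?_, fun x => ?_, fun x hx => ?_, fun x => ?_⟩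
  · exact tendsto_nhds_unique (hu (-x)) ((hu x).neg.congr fun n => ((it n).odd x).symm)
  · exact le_of_tendsto' (hu x).abs fun n => (it n).bound x
  · exact le_of_tendsto_of_tendsto' (hu x) (hu (x + L)) fun n => (it n).shift x
  · exact (hαp x hx).trans_le (ge_of_tendsto' (hu x) fun n => (it n).lower x hx)
  · refine tendsto_nhds_unique (S.tendsto_fixedPointMap (fun n => (it n).measurable)
      (fun n => (it n).bound) hu x) (((hu x).comp (tendsto_add_atTop_nat 1)).congr fun n => ?_)
    simp only [Function.comp, Function.iterate_succ_apply', hT]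

/-- The translates by periods of a solution that increases under them converge to a periodic
solution. -/
lemma exists_periodic_limit (S : Setting g L a b M k c) {u : ℝ → ℝ} (hu : Measurable u)
    (hM : ∀ y, |u y| ≤ M) (hs : ∀ y, u y ≤ u (y + L)) (hp : ∀ y, 0 < y → 0 < u y)
    (hfix : ∀ x, fixedPointMap g k c u x = u x) :
    ∃ w : ℝ → ℝ, Measurable w ∧ Function.Periodic w L ∧ (∀ x, 0 < w x) ∧ (∀ x, |w x| ≤ M) ∧
      (∀ x, Monotone fun n : ℕ => u (x + n * L)) ∧
      (∀ x, Tendsto (fun n : ℕ => u (x + n * L)) atTop (𝓝 (w x))) ∧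
      ∀ x, fixedPointMap g k c w x = w x := by
  have hmono : ∀ x, Monotone fun n : ℕ => u (x + n * L) := fun x =>
    monotone_nat_of_le_succ fun n => by
      have := hs (x + n * L)
      push_cast
      rwa [add_mul, one_mul, ← add_assoc]
  have hbdd : ∀ x, BddAbove (range fun n : ℕ => u (x + n * L)) := fun x =>
    ⟨M, by rintro _ ⟨n, rfl⟩; exact (abs_le.1 (hM _)).2⟩
  have hlim : ∀ x, ∃ l, Tendsto (fun n : ℕ => u (x + n * L)) atTop (𝓝 l) := fun x =>
    ⟨_, tendsto_atTop_ciSup (hmono x) (hbdd x)⟩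
  choose w hw using hlim
  have hmeas : ∀ n : ℕ, Measurable fun x => u (x + n * L) := fun n => by fun_prop
  refine ⟨w, measurable_of_tendsto_metrizable hmeas (tendsto_pi_nhds.2 hw), fun x => ?_,
    fun x => ?_, fun x => ?_, hmono, hw, fun x => ?_⟩
  · refine tendsto_nhds_unique (hw (x + L)) (((hw x).comp (tendsto_add_atTop_nat 1)).congr
      fun n => ?_)
    simp only [Function.comp]
    push_cast
    ring_nf
  · obtain ⟨n, hn⟩ := exists_nat_gt (-x / L)
    rw [div_lt_iff₀ S.L_pos] at hn
    exact (hp (x + n * L) (by linarith)).trans_le ((hmono x).ge_of_tendsto (hw x) n)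
  · exact le_of_tendsto' (hw x).abs fun n => hM _
  · refine tendsto_nhds_unique (S.tendsto_fixedPointMap hmeas (fun n y => hM _) hw x)
      ((hw x).congr fun n => ?_)
    rw [S.fixedPointMap_shift, hfix]

end Setting

end DarkSoliton

/-! ### Stationary solutions -/

namespace DarkSoliton

open Set

lemma IsStationarySolution.of_hasDerivAt {g ω : ℝ} {V φ φ' : ℝ → ℝ} (hV : Continuous V)
    (h1 : ∀ x, HasDerivAt φ (φ' x) x)
    (h2 : ∀ x, HasDerivAt φ' (φ x ^ 5 + g * φ x ^ 3 - (ω + V x) * φ x) x) :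
    IsStationarySolution g 1 ω V φ := by
  have e1 : deriv φ = φ' := funext fun x => (h1 x).deriv
  have e2 : deriv φ' = fun x => φ x ^ 5 + g * φ x ^ 3 - (ω + V x) * φ x :=
    funext fun x => (h2 x).deriv
  have hφ : Continuous φ := continuous_iff_continuousAt.2 fun x => (h1 x).continuousAt
  refine ⟨?_, fun x => ?_⟩
  · rw [← one_add_one_eq_two, contDiff_succ_iff_deriv]
    refine ⟨fun x => (h1 x).differentiableAt, by simp, ?_⟩
    rw [e1, contDiff_one_iff_deriv]
    refine ⟨fun x => (h2 x).differentiableAt, ?_⟩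
    rw [e2]
    fun_prop
  · rw [e1, e2]
    ring

lemma IsStationarySolution.hasDerivAt {g ω : ℝ} {V φ : ℝ → ℝ}
    (h : IsStationarySolution g 1 ω V φ) : (∀ x, HasDerivAt φ (deriv φ x) x) ∧
      ∀ x, HasDerivAt (deriv φ) (φ x ^ 5 + g * φ x ^ 3 - (ω + V x) * φ x) x := by
  obtain ⟨hd, he⟩ := h
  rw [← one_add_one_eq_two, contDiff_succ_iff_deriv] at hd
  refine ⟨fun x => (hd.1 x).hasDerivAt, fun x => ?_⟩
  have h2 := ((contDiff_one_iff_deriv.1 hd.2.2).1 x).hasDerivAt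
  refine h2.congr_deriv ?_
  linarith [he x]

lemma IsStationarySolution.neg {g₁ g₂ ω : ℝ} {V φ : ℝ → ℝ}
    (h : IsStationarySolution g₁ g₂ ω V φ) : IsStationarySolution g₁ g₂ ω V fun x => -φ x := by
  refine ⟨h.1.neg, fun x => ?_⟩
  have e : deriv (fun x => -φ x) = fun x => -deriv φ x := deriv.fun_neg'
  rw [e, deriv.fun_neg]
  linear_combination -h.2 x

lemma IsStationarySolution.comp_neg {g₁ g₂ ω : ℝ} {V φ : ℝ → ℝ} (hV : Function.Even V)
    (h : IsStationarySolution g₁ g₂ ω V φ) : IsStationarySolution g₁ g₂ ω V fun x => φ (-x) := by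
  refine ⟨h.1.comp contDiff_neg, fun x => ?_⟩
  have e : deriv (fun x => φ (-x)) = fun x => -deriv φ (-x) := funext fun x => deriv_comp_neg φ x
  rw [e, deriv.fun_neg, deriv_comp_neg, neg_neg, ← hV x]
  exact h.2 (-x)

lemma IsStationarySolution.isCQNLSSolution {g₁ g₂ ω : ℝ} {V φ : ℝ → ℝ}
    (h : IsStationarySolution g₁ g₂ ω V φ) : IsCQNLSSolution g₁ g₂ V
      (fun t x => Complex.exp (-(Complex.I * (ω : ℂ) * (t : ℂ))) * (φ x : ℂ)) := by
  have ht : ∀ (x t : ℝ), HasDerivAt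
      (fun t : ℝ => Complex.exp (-(Complex.I * (ω : ℂ) * (t : ℂ))) * (φ x : ℂ))
      (Complex.exp (-(Complex.I * (ω : ℂ) * (t : ℂ))) * (-(Complex.I * ω)) * (φ x : ℂ)) t := by
    intro x t
    have h1 : HasDerivAt (fun t : ℝ => -(Complex.I * (ω : ℂ) * (t : ℂ))) (-(Complex.I * ω)) t := by
      exact (((Complex.ofRealCLM.hasDerivAt (x := t)).const_mul (Complex.I * (ω : ℂ))).neg).congr_deriv
        (by simp)
    exact (h1.cexp).mul_const _
  have hof : ∀ {f : ℝ → ℝ} (z : ℂ) (x : ℝ), DifferentiableAt ℝ f x →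
      deriv (fun x => z * (f x : ℂ)) x = z * ((deriv f x : ℝ) : ℂ) := fun {f} z x hf =>
    (hf.hasDerivAt.ofReal_comp.const_mul z).deriv
  have hd := h.1
  rw [← one_add_one_eq_two, contDiff_succ_iff_deriv] at hd
  refine ⟨fun x t => (ht x t).differentiableAt, fun t => ?_, fun t x => ?_⟩
  · exact contDiff_const.mul (Complex.ofRealCLM.contDiff.comp h.1)
  · have e1 : deriv (fun x => Complex.exp (-(Complex.I * (ω : ℂ) * (t : ℂ))) * (φ x : ℂ)) =
        fun x => Complex.exp (-(Complex.I * (ω : ℂ) * (t : ℂ))) * ((deriv φ x : ℝ) : ℂ) :=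
      funext fun x => hof _ x (hd.1 x)
    have en : ‖Complex.exp (-(Complex.I * (ω : ℂ) * (t : ℂ))) * (φ x : ℂ)‖ = |φ x| := by
      rw [norm_mul, Complex.norm_exp, Complex.norm_real, Real.norm_eq_abs]
      simp
    have e4 : |φ x| ^ 4 = φ x ^ 4 := (by decide : Even 4).pow_abs _
    rw [(ht x t).deriv, e1, hof _ x ((contDiff_one_iff_deriv.1 hd.2.2).1 x), en, sq_abs, e4]
    have hx : ((deriv (deriv φ) x + (ω + V x) * φ x - g₁ * φ x ^ 3 - g₂ * φ x ^ 5 : ℝ) : ℂ) = 0 := by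
      rw [h.2 x, Complex.ofReal_zero]
    push_cast at hx ⊢
    linear_combination Complex.exp (-(Complex.I * (ω : ℂ) * (t : ℂ))) * hx -
      Complex.exp (-(Complex.I * (ω : ℂ) * (t : ℂ))) * ω * φ x * Complex.I_sq

/-! ### The equilibrium -/

lemma equilibrium_sq {g μ : ℝ} (hμ : 0 < μ) :
    equilibrium g μ ^ 2 = (√(g ^ 2 + 4 * μ) - g) / 2 := by
  have h : |g| ≤ √(g ^ 2 + 4 * μ) := Real.abs_le_sqrt (by linarith)
  unfold equilibrium
  rw [div_pow, Real.sq_sqrt zero_le_two, Real.sq_sqrt (by linarith [le_abs_self g])]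

lemma equilibrium_pos {g μ : ℝ} (hμ : 0 < μ) : 0 < equilibrium g μ := by
  have h : |g| < √(g ^ 2 + 4 * μ) := Real.lt_sqrt_of_sq_lt (by rw [sq_abs]; linarith)
  unfold equilibrium
  exact div_pos (Real.sqrt_pos.2 (by linarith [le_abs_self g])) (by positivity)

lemma equilibrium_eq {g μ : ℝ} (hμ : 0 < μ) :
    equilibrium g μ ^ 4 + g * equilibrium g μ ^ 2 = μ := by
  have h := equilibrium_sq (g := g) hμ
  have hs : √(g ^ 2 + 4 * μ) ^ 2 = g ^ 2 + 4 * μ := Real.sq_sqrt (by positivity)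
  have e : equilibrium g μ ^ 4 = (equilibrium g μ ^ 2) ^ 2 := by ring
  rw [e, h]
  linear_combination hs / 4

lemma equilibrium_le {g μ y : ℝ} (hμ : 0 < μ) (hy : 0 < y) (h : μ ≤ y ^ 4 + g * y ^ 2) :
    equilibrium g μ ≤ y := by
  have hp := equilibrium_pos (g := g) hμ
  have he := equilibrium_eq (g := g) hμ
  generalize equilibrium g μ = ρ at hp he
  have h1 : 0 < ρ ^ 2 + g := by
    refine pos_of_mul_pos_right (a := ρ ^ 2) ?_ (sq_nonneg ρ)
    nlinarith
  by_contra! hlt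
  have h2 : y ^ 2 < ρ ^ 2 := by gcongr
  have : 0 < (ρ ^ 2 - y ^ 2) * (ρ ^ 2 + y ^ 2 + g) :=
    mul_pos (by linarith) (by linarith [sq_nonneg y])
  nlinarith

/-! ### Uniqueness of the periodic background -/

lemma deriv2_nonpos_of_isLocalMax {f f' : ℝ → ℝ} {x₀ f₂ : ℝ} (h1 : ∀ x, HasDerivAt f (f' x) x)
    (h2 : HasDerivAt f' f₂ x₀) (hmax : IsLocalMax f x₀) : f₂ ≤ 0 := by
  by_contra! hpos
  have e1 : deriv f = f' := funext fun x => (h1 x).deriv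
  have hmin : IsLocalMin f x₀ := isLocalMin_of_deriv_deriv_pos (by rw [e1, h2.deriv]; exact hpos)
    hmax.deriv_eq_zero (h1 x₀).continuousAt
  have hev : f =ᶠ[𝓝 x₀] fun _ => f x₀ := by
    filter_upwards [hmin, hmax] with x hx hx'
    exact le_antisymm hx' hx
  have h3 : f' =ᶠ[𝓝 x₀] fun _ => 0 := by
    filter_upwards [hev.eventuallyEq_nhds] with x hx
    exact (h1 x).unique ((hasDerivAt_const x (f x₀)).congr_of_eventuallyEq hx)
  exact hpos.ne' (h2.unique ((hasDerivAt_const x₀ (0 : ℝ)).congr_of_eventuallyEq h3))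

lemma exists_forall_le_of_periodic {f : ℝ → ℝ} {L : ℝ} (hL : 0 < L) (hf : Continuous f)
    (hp : Function.Periodic f L) : ∃ x₀, ∀ x, f x ≤ f x₀ := by
  obtain ⟨x₀, -, h⟩ := isCompact_Icc.exists_isMaxOn (nonempty_Icc.2 hL.le) hf.continuousOn
  refine ⟨x₀, fun x => ?_⟩
  obtain ⟨y, hy, hxy⟩ := hp.exists_mem_Ico₀ hL x
  rw [hxy]
  exact h (Ico_subset_Icc_self hy)

/-- Since `y ↦ y⁴ + g y²` increases where `2 y² + g > 0`, periodic solutions in that range are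
comparable: at a maximum point of `u / v` the equation forces `u ≤ v`. -/
lemma le_of_periodic_solutions {g L : ℝ} {c u u' v v' : ℝ → ℝ} (hL : 0 < L)
    (hu : ∀ x, HasDerivAt u (u' x) x)
    (hu' : ∀ x, HasDerivAt u' (u x ^ 5 + g * u x ^ 3 - c x * u x) x)
    (hv : ∀ x, HasDerivAt v (v' x) x)
    (hv' : ∀ x, HasDerivAt v' (v x ^ 5 + g * v x ^ 3 - c x * v x) x)
    (hup : Function.Periodic u L) (hvp : Function.Periodic v L) (hu0 : ∀ x, 0 < u x)
    (hv0 : ∀ x, 0 < v x) (hg : ∀ x, 0 < u x ^ 2 + v x ^ 2 + g) (x : ℝ) : u x ≤ v x := by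
  have cu : Continuous u := continuous_iff_continuousAt.2 fun x => (hu x).continuousAt
  have cv : Continuous v := continuous_iff_continuousAt.2 fun x => (hv x).continuousAt
  obtain ⟨x₀, hx₀⟩ := exists_forall_le_of_periodic (f := fun x => u x / v x) hL
    (cu.div cv fun x => (hv0 x).ne') (fun x => by simp only [hup x, hvp x])
  -- `u - l v` has its maximum `0` at `x₀`
  set l := u x₀ / v x₀ with hl
  have hl0 : u x₀ = l * v x₀ := (div_mul_cancel₀ _ (hv0 x₀).ne').symm
  have hle : ∀ x, u x ≤ l * v x := fun x => (div_le_iff₀ (hv0 x)).1 (hx₀ x)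
  have hd := deriv2_nonpos_of_isLocalMax (f := fun x => u x - l * v x) (x₀ := x₀)
    (fun x => (hu x).sub ((hv x).const_mul l)) ((hu' x₀).sub ((hv' x₀).const_mul l))
    (Eventually.of_forall fun x => by simp only; linarith [hle x])
  have e : u x₀ ^ 5 + g * u x₀ ^ 3 - c x₀ * u x₀ - l * (v x₀ ^ 5 + g * v x₀ ^ 3 - c x₀ * v x₀) =
      u x₀ * (u x₀ + v x₀) * (u x₀ ^ 2 + v x₀ ^ 2 + g) * (u x₀ - v x₀) := by
    linear_combination (v x₀ ^ 4 + g * v x₀ ^ 2 - c x₀) * hl0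
  rw [e] at hd
  have h1 : u x₀ ≤ v x₀ := by
    by_contra! hlt
    have := mul_pos (mul_pos (mul_pos (hu0 x₀) (add_pos (hu0 x₀) (hv0 x₀))) (hg x₀))
      (sub_pos.2 hlt)
    linarith
  have h2 : l ≤ 1 := (div_le_one (hv0 x₀)).2 h1
  exact (hle x).trans (mul_le_of_le_one_left (hv0 x).le h2)

lemma IsPeriodicBackground.unique {g ω L Vmin Vmax : ℝ} {V u v : ℝ → ℝ} (hL : 0 < L)
    (hω : 0 < ω + Vmin) (hu : IsPeriodicBackground g ω L Vmin Vmax V u)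
    (hv : IsPeriodicBackground g ω L Vmin Vmax V v) : u = v := by
  obtain ⟨u1, u2⟩ := hu.1.hasDerivAt
  obtain ⟨v1, v2⟩ := hv.1.hasDerivAt
  have hp := equilibrium_pos (g := g) hω
  have hs := equilibrium_sq (g := g) hω
  have hroot : 0 < √(g ^ 2 + 4 * (ω + Vmin)) := Real.sqrt_pos.2 (by positivity)
  have hsq : ∀ {y : ℝ}, equilibrium g (ω + Vmin) ≤ y → equilibrium g (ω + Vmin) ^ 2 ≤ y ^ 2 :=
    fun h => by gcongr
  have hu0 := fun x => hp.trans_le (hu.2.2 x).1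
  have hv0 := fun x => hp.trans_le (hv.2.2 x).1
  refine funext fun x => le_antisymm
    (le_of_periodic_solutions (c := fun x => ω + V x) hL u1 u2 v1 v2 hu.2.1 hv.2.1 hu0 hv0
      (fun x => ?_) x)
    (le_of_periodic_solutions (c := fun x => ω + V x) hL v1 v2 u1 u2 hv.2.1 hu.2.1 hv0 hu0
      (fun x => ?_) x)
  all_goals linarith [hsq (hu.2.2 x).1, hsq (hv.2.2 x).1]

/-- A positive periodic solution lies above the lower equilibrium, by the equation at its
minimum. -/
lemma equilibrium_le_of_periodic_solution {g L a : ℝ} {c w w' : ℝ → ℝ} (hL : 0 < L) (ha : 0 < a)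
    (hc : ∀ x, a ≤ c x) (h1 : ∀ x, HasDerivAt w (w' x) x)
    (h2 : ∀ x, HasDerivAt w' (w x ^ 5 + g * w x ^ 3 - c x * w x) x)
    (hp : Function.Periodic w L) (h0 : ∀ x, 0 < w x) (x : ℝ) : equilibrium g a ≤ w x := by
  have hw : Continuous w := continuous_iff_continuousAt.2 fun x => (h1 x).continuousAt
  obtain ⟨x₀, hx₀⟩ := exists_forall_le_of_periodic (f := fun x => -w x) hL hw.neg
    (fun x => by simp only [hp x])
  have hd := deriv2_nonpos_of_isLocalMax (f := fun x => -w x) (x₀ := x₀)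
    (fun x => (h1 x).neg) (h2 x₀).neg (Eventually.of_forall hx₀)
  refine (equilibrium_le ha (h0 x₀) ?_).trans (neg_le_neg_iff.1 (hx₀ x))
  have h3 : 0 ≤ w x₀ * (w x₀ ^ 4 + g * w x₀ ^ 2 - c x₀) := by linarith
  have h4 := nonneg_of_mul_nonneg_right h3 (h0 x₀)
  linarith [hc x₀]

/-! ### Convergence at infinity -/

/-- By Dini's theorem, pointwise monotone convergence of the translates by periods to a periodic
function is uniform on a period. -/
lemma tendsto_sub_of_translates {L : ℝ} {u w : ℝ → ℝ} (hL : 0 < L) (hu : Continuous u)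
    (hw : Continuous w) (hp : Function.Periodic w L)
    (hmono : ∀ x, Monotone fun n : ℕ => u (x + n * L))
    (hlim : ∀ x, Tendsto (fun n : ℕ => u (x + n * L)) atTop (𝓝 (w x))) :
    Tendsto (fun x => u x - w x) atTop (𝓝 0) := by
  have hunif : TendstoUniformlyOn (fun (n : ℕ) x => u (x + n * L)) w atTop (Icc 0 L) :=
    Monotone.tendstoUniformlyOn_of_forall_tendsto isCompact_Icc
      (fun n => by fun_prop) (fun x _ => hmono x) hw.continuousOn (fun x _ => hlim x)
  rw [Metric.tendstoUniformlyOn_iff] at hunif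
  rw [Metric.tendsto_atTop]
  intro ε hε
  obtain ⟨N, hN⟩ := eventually_atTop.1 (hunif ε hε)
  refine ⟨N * L, fun x hx => ?_⟩
  have hx0 : 0 ≤ x / L := div_nonneg ((by positivity : (0 : ℝ) ≤ N * L).trans hx) hL.le
  have f1 := Nat.floor_le hx0
  have f2 := Nat.lt_floor_add_one (x / L)
  rw [le_div_iff₀ hL] at f1
  rw [div_lt_iff₀ hL] at f2
  have h := hN ⌊x / L⌋₊ (Nat.le_floor ((le_div_iff₀ hL).2 hx)) (x - ⌊x / L⌋₊ * L)
    ⟨by linarith, by linarith⟩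
  rw [hp.sub_nat_mul_eq, sub_add_cancel, dist_comm, Real.dist_eq] at h
  rwa [Real.dist_eq, sub_zero]

/-- A function that tends to zero along with its second derivative has a derivative that tends to
zero. -/
lemma tendsto_deriv_zero_of_deriv2 {f f' f₂ : ℝ → ℝ} (h1 : ∀ x, HasDerivAt f (f' x) x)
    (h2 : ∀ x, HasDerivAt f' (f₂ x) x) (hf : Tendsto f atTop (𝓝 0))
    (hf₂ : Tendsto f₂ atTop (𝓝 0)) : Tendsto f' atTop (𝓝 0) := by
  rw [Metric.tendsto_atTop] at *
  simp only [Real.dist_eq, sub_zero] at *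
  intro ε hε
  obtain ⟨N, hN⟩ := hf (ε / 3) (by positivity)
  obtain ⟨K, hK⟩ := hf₂ (ε / 3) (by positivity)
  -- two applications of the mean value theorem give `f' x = f (x + 1) - f x - f₂ η * (ξ - x)` with
  -- `x < η < ξ < x + 1`
  refine ⟨max N K, fun x hx => ?_⟩
  have hxN := (le_max_left N K).trans hx
  have hxK := (le_max_right N K).trans hx
  obtain ⟨ξ, hξ, eξ⟩ := exists_hasDerivAt_eq_slope f f' (lt_add_one x)
    (fun y _ => (h1 y).continuousAt.continuousWithinAt) fun y _ => h1 y
  obtain ⟨η, hη, eη⟩ := exists_hasDerivAt_eq_slope f' f₂ hξ.1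
    (fun y _ => (h2 y).continuousAt.continuousWithinAt) fun y _ => h2 y
  rw [add_sub_cancel_left, div_one] at eξ
  rw [eq_div_iff (sub_pos.2 hξ.1).ne'] at eη
  have b1 := hN x hxN
  have b2 := hN (x + 1) (by linarith)
  have b3 : |f₂ η * (ξ - x)| ≤ ε / 3 := by
    rw [abs_mul, abs_of_pos (sub_pos.2 hξ.1)]
    have := hK η (hxK.trans hη.1.le)
    nlinarith [hξ.1, hξ.2, abs_nonneg (f₂ η)]
  have e : f' x = f (x + 1) - f x - f₂ η * (ξ - x) := by linarith
  rw [e]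
  rw [abs_le] at b3
  rw [abs_lt] at *
  constructor <;> linarith

/-! ### Existence of the dark soliton -/

/-- An odd dark soliton exists at every frequency `ω > -Vmin`. -/
lemma exists_isOddDarkSoliton {g L Vmin Vmax ω : ℝ} {V : ℝ → ℝ} (hL : 0 < L)
    (hcont : Continuous V) (hper : Function.Periodic V L) (heven : Function.Even V)
    (hmin : ∀ x, Vmin ≤ V x) (hmax : ∀ x, V x ≤ Vmax) (hω : -Vmin < ω) :
    ∃ φ : ℝ → ℝ, IsOddDarkSoliton g ω L Vmin Vmax V φ := by
  have ha : 0 < ω + Vmin := by linarith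
  have hb : 0 < ω + Vmax := by linarith [hmin 0, hmax 0]
  set M := equilibrium g (ω + Vmax) with hMdef
  have S : Setting g L (ω + Vmin) (ω + Vmax) M (1 + 3 * |g| * M ^ 2 + 5 * M ^ 4)
      (fun x => ω + V x) :=
    { L_pos := hL
      a_pos := ha
      M_pos := equilibrium_pos hb
      M_eq := equilibrium_eq hb
      k_eq := rfl
      cont := by fun_prop
      periodic := fun x => by simp only [hper x]
      even := fun x => by simp only [heven x]
      le_c := fun x => by linarith [hmin x]
      c_le := fun x => by linarith [hmax x] }
  obtain ⟨u, um, uo, uM, us, up, uT⟩ := S.exists_odd_fixedPoint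
  obtain ⟨w, wm, wper, wpos, wM, mono, lim, wT⟩ := S.exists_periodic_limit um uM us up uT
  obtain ⟨u', u1, u2⟩ := S.hasDerivAt_of_fixedPoint um uM uT
  obtain ⟨w', w1, w2⟩ := S.hasDerivAt_of_fixedPoint wm wM wT
  have cu : Continuous u := continuous_iff_continuousAt.2 fun x => (u1 x).continuousAt
  have cw : Continuous w := continuous_iff_continuousAt.2 fun x => (w1 x).continuousAt
  have su : IsStationarySolution g 1 ω V u := .of_hasDerivAt hcont u1 u2
  have sw : IsStationarySolution g 1 ω V w := .of_hasDerivAt hcont w1 w2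
  have eu : deriv u = u' := funext fun x => (u1 x).deriv
  have ew : deriv w = w' := funext fun x => (w1 x).deriv
  have bw : IsPeriodicBackground g ω L Vmin Vmax V w := ⟨sw, wper, fun x =>
    ⟨equilibrium_le_of_periodic_solution hL ha S.le_c w1 w2 wper wpos x, (abs_le.1 (wM x)).2⟩⟩
  have we : Function.Even w := fun x => by
    refine congrFun (IsPeriodicBackground.unique hL ha
      (u := fun x => w (-x)) ⟨sw.comp_neg heven, fun x => ?_, fun x => bw.2.2 (-x)⟩ bw) x
    simp only [neg_add]
    exact wper.sub_eq (-x)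
  have t0 : Tendsto (fun x => u x - w x) atTop (𝓝 0) :=
    tendsto_sub_of_translates hL cu cw wper mono lim
  have t2 : Tendsto (fun x => (u x ^ 5 + g * u x ^ 3 - (ω + V x) * u x) -
      (w x ^ 5 + g * w x ^ 3 - (ω + V x) * w x)) atTop (𝓝 0) := by
    refine squeeze_zero_norm (a := fun x => (3 * |g| * M ^ 2 + 5 * M ^ 4 + (ω + Vmax)) *
      |u x - w x|) (fun x => ?_) (by simpa using t0.abs.const_mul _)
    have e : (u x ^ 5 + g * u x ^ 3 - (ω + V x) * u x) -
        (w x ^ 5 + g * w x ^ 3 - (ω + V x) * w x) =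
        ((g * (u x ^ 2 + u x * w x + w x ^ 2) + (u x ^ 4 + u x ^ 3 * w x + u x ^ 2 * w x ^ 2 +
          u x * w x ^ 3 + w x ^ 4)) - (ω + V x)) * (u x - w x) := by ring
    rw [e, norm_mul, Real.norm_eq_abs, Real.norm_eq_abs]
    refine mul_le_mul_of_nonneg_right ((abs_sub _ _).trans (add_le_add
      (abs_power_quotient_le (uM x) (wM x)) ?_)) (abs_nonneg _)
    rw [abs_of_pos (by linarith [hmin x])]
    linarith [hmax x]
  have t1 : Tendsto (fun x => u' x - w' x) atTop (𝓝 0) :=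
    tendsto_deriv_zero_of_deriv2 (fun x => (u1 x).sub (w1 x)) (fun x => (u2 x).sub (w2 x)) t0 t2
  -- `u'` is even and `w'` is odd, which carries the asymptotics from `+∞` to `-∞`
  have u'e : ∀ x, u' (-x) = u' x := fun x => by
    have h : HasDerivAt u (- -u' (-x)) x := by
      have h3 := ((u1 (-x)).comp x (hasDerivAt_neg x)).neg
      have e : -(u ∘ Neg.neg) = u := funext fun y => by simp [uo y]
      rw [e] at h3
      simpa using h3
    simpa using h.unique (u1 x)
  have w'o : ∀ x, w' (-x) = -w' x := fun x => by
    have h : HasDerivAt w (-w' (-x)) x := by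
      have h3 := (w1 (-x)).comp x (hasDerivAt_neg x)
      have e : w ∘ Neg.neg = w := funext fun y => by simp [we y]
      rw [e] at h3
      simpa using h3
    linarith [h.unique (w1 x)]
  have enw : deriv (fun x => -w x) = fun x => -w' x := by rw [deriv.fun_neg', ew]
  refine ⟨u, uo, w, bw, fun χ hχ => hχ.unique hL ha bw, ?_⟩
  exact
    { stationary := su
      cqnls := su.isCQNLSSolution
      stationary_left := sw.neg
      stationary_right := sw
      periodic_left := fun x => by simp only [wper x]
      periodic_right := wper
      neg_left := fun x => neg_lt_zero.2 (wpos x)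
      pos_right := wpos
      tendsto_left := by
        have h := (t0.comp tendsto_neg_atBot_atTop).neg
        rw [neg_zero] at h
        refine h.congr fun x => ?_
        simp only [Function.comp, uo x, we x]
        ring
      tendsto_deriv_left := by
        refine (t1.comp tendsto_neg_atBot_atTop).congr fun x => ?_
        rw [eu, enw]
        simp only [Function.comp, u'e x, w'o x]
      tendsto_right := t0
      tendsto_deriv_right := by rwa [eu, ew] }

/-! ### Frequencies -/

/-- A function solves the stationary equation for one frequency only, unless it vanishes; a dark
soliton does not, since its periodic background stays above a positive equilibrium. -/
lemma IsOddDarkSoliton.frequency_unique {g L Vmin Vmax ω ω' : ℝ} {V φ : ℝ → ℝ}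
    (hω : -Vmin < ω) (h : IsOddDarkSoliton g ω L Vmin Vmax V φ)
    (h' : IsOddDarkSoliton g ω' L Vmin Vmax V φ) : ω = ω' := by
  obtain ⟨-, φp, hb, -, hd⟩ := h
  obtain ⟨-, _, -, -, hd'⟩ := h'
  by_contra hne
  have h0 : ∀ x, φ x = 0 := fun x => by
    have e : (ω - ω') * φ x = 0 := by linarith [hd.stationary.2 x, hd'.stationary.2 x]
    exact (mul_eq_zero.1 e).resolve_left (sub_ne_zero.2 hne)
  have hp := equilibrium_pos (g := g) (by linarith : 0 < ω + Vmin)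
  have ht := ge_of_tendsto' hd.tendsto_right.neg fun x => by
    simp only [h0 x, zero_sub, neg_neg]
    exact (hb.2.2 x).1
  linarith

lemma frequencyCondition_of_omegaZero_lt {g Vmin Vmax ω : ℝ} (hV : Vmin ≤ Vmax)
    (h : omegaZero g Vmin Vmax < ω) : -Vmin < ω ∧ FrequencyCondition g ω Vmin Vmax := by
  unfold omegaZero at h
  split_ifs at h with hg
  · have hS := Real.sq_sqrt (le_max_left 0 (5 * g ^ 2 + 4 * (Vmax - 4 * Vmin)))
    have hS' := le_max_right 0 (5 * g ^ 2 + 4 * (Vmax - 4 * Vmin))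
    have hS0 := Real.sqrt_nonneg (max 0 (5 * g ^ 2 + 4 * (Vmax - 4 * Vmin)))
    generalize √(max 0 (5 * g ^ 2 + 4 * (Vmax - 4 * Vmin))) = s at h hS hS0
    rw [← hS] at hS'
    have hω : -Vmin < ω := by nlinarith [mul_nonneg hg hS0, sq_nonneg g, sq_nonneg s]
    refine ⟨hω, Or.inl ⟨hg, ?_⟩⟩
    have ht : √(g ^ 2 + 4 * ω + 4 * Vmin) ^ 2 = g ^ 2 + 4 * ω + 4 * Vmin :=
      Real.sq_sqrt (by nlinarith [sq_nonneg g])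
    have hlt : 2 * g + s < √(g ^ 2 + 4 * ω + 4 * Vmin) := Real.lt_sqrt_of_sq_lt (by linarith)
    generalize √(g ^ 2 + 4 * ω + 4 * Vmin) = t at ht hlt
    -- in terms of `t` the condition reads `5 g² + 4 (Vmax - 4 Vmin) < (t - 2 g)²`
    have h3 : s ^ 2 < (t - 2 * g) ^ 2 := by
      have : s < t - 2 * g := by linarith
      gcongr
    linarith
  · obtain ⟨h1, h2⟩ := max_lt_iff.1 h
    push Not at hg
    refine ⟨h1, Or.inr ⟨hg, ?_⟩⟩
    rw [abs_of_neg hg] at h2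
    have hA := Real.sq_sqrt (by nlinarith [sq_nonneg g] : 0 ≤ 4 * ω + g ^ 2 + 4 * Vmin)
    have hB := Real.sq_sqrt (by nlinarith [sq_nonneg g] : 0 ≤ 4 * ω + g ^ 2 + 4 * Vmax)
    have hD := Real.sq_sqrt (sub_nonneg.2 hV)
    have hA0 := Real.sqrt_nonneg (4 * ω + g ^ 2 + 4 * Vmin)
    have hD0 := Real.sqrt_nonneg (Vmax - Vmin)
    -- subadditivity of the square root
    have hAB : √(4 * ω + g ^ 2 + 4 * Vmax) ≤ √(4 * ω + g ^ 2 + 4 * Vmin) + 2 * √(Vmax - Vmin) :=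
      Real.sqrt_le_iff.2 ⟨by positivity, by nlinarith [mul_nonneg hA0 hD0]⟩
    nlinarith [mul_nonneg_of_nonpos_of_nonpos hg.le (sub_nonpos.2 hAB),
      mul_nonneg_of_nonpos_of_nonpos hg.le (neg_nonpos.2 hA0)]

end DarkSoliton

theorem mainTheorem1 (g₁ L Vmin Vmax : ℝ) (V : ℝ → ℝ) (hL : 0 < L)
    (hcont : Continuous V) (hper : Function.Periodic V L) (heven : Function.Even V)
    (hmin : ∀ x, Vmin ≤ V x) (hmax : ∀ x, V x ≤ Vmax) :
    (∀ ω : ℝ, -Vmin < ω →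
      (DarkSoliton.MonotonicityCondition g₁ ω L Vmin Vmax V ∨
        DarkSoliton.FrequencyCondition g₁ ω Vmin Vmax) →
      ∃ φ : ℝ → ℝ, DarkSoliton.IsOddDarkSoliton g₁ ω L Vmin Vmax V φ) ∧
    (∀ ω : ℝ, DarkSoliton.omegaZero g₁ Vmin Vmax < ω →
      -Vmin < ω ∧ DarkSoliton.FrequencyCondition g₁ ω Vmin Vmax) ∧
    (∃ Φ : ℝ → ℝ → ℝ,
      Set.InjOn Φ (Set.Ioi (DarkSoliton.omegaZero g₁ Vmin Vmax)) ∧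
      ∀ ω : ℝ, DarkSoliton.omegaZero g₁ Vmin Vmax < ω →
        DarkSoliton.IsOddDarkSoliton g₁ ω L Vmin Vmax V (Φ ω)) := by
  have hex := fun {ω : ℝ} => DarkSoliton.exists_isOddDarkSoliton (g := g₁) (ω := ω) hL hcont hper
    heven hmin hmax
  have hfreq := fun {ω : ℝ} => DarkSoliton.frequencyCondition_of_omegaZero_lt (g := g₁) (ω := ω)
    ((hmin 0).trans (hmax 0))
  refine ⟨fun ω hω _ => hex hω, fun ω hω => hfreq hω, ?_⟩
  choose! Φ hΦ using fun ω (hω : DarkSoliton.omegaZero g₁ Vmin Vmax < ω) => hex (hfreq hω).1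
  exact ⟨Φ, fun ω hω ω' hω' e =>
    (hΦ ω hω).frequency_unique (hfreq hω).1 (e ▸ hΦ ω' hω'), hΦ⟩
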